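/- Write $\mathbb{Z}_L=\{\dots,-2,-1\}$ and $\mathbb{Z}_R=\{0,1,2,\dots\}$. (Quantum spin lattice systems.) Let $\mathcal{A}_{\mathbb{Z}}$ be a quantum spin lattice system on $\mathbb{Z}$, i.e. a unital $C^*$-algebra with subalgebras $\mathcal{A}(I)$ ($I\subset\mathbb{Z}$ finite), each isomorphic to a full matrix algebra $M_k(\mathbb{C})$ for some $k\ge 1$, such that $\mathcal{A}(I\cup J)=\mathcal{A}(I)\otimes\mathcal{A}(J)$ (via $A\otimes B\mapsto AB$) for disjoint $I,J$, and such that $\bigcup_I\mathcal{A}(I)$ is norm dense. Let $\mathcal{A}_L$ (resp. $\mathcal{A}_R$) be the $C^*$-subalgebra generated by all $\mathcal{A}(I)$ with $I\subset\mathbb{Z}_L$ (resp. $I\subset\mathbb{Z}_R$) finite. Then for every $*$-automorphism $\alpha_L$ of $\mathcal{A}_L$ and every $*$-automorphism $\alpha_R$ of $\mathcal{A}_R$ there exists a $*$-automorphism $\alpha_L\otimes\alpha_R$ of $\mathcal{A}_{\mathbb{Z}}$ such that $$(\alpha_L\otimes\alpha_R)\Bigl(\sum_k A_kB_k\Bigr)=\sum_k\alpha_L(A_k)\,\alpha_R(B_k)$$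 for every finite sum with $A_k\in\mathcal{A}_L$ and $B_k\in\mathcal{A}_R$. (Fermion lattice systems.) Let $\mathcal{A}_{\mathbb{Z}}$ be a fermion lattice system on $\mathbb{Z}$, i.e. a nonzero unital $C^*$-algebra in which the $*$-algebra generated by elements $c_i$, $i\in\mathbb{Z}$, is norm dense, where $c_i^*c_j+c_jc_i^*=\delta_{ij}1$ and $c_ic_j+c_jc_i=0=c_i^*c_j^*+c_j^*c_i^*$. Let $\mathcal{A}_L$ (resp. $\mathcal{A}_R$) be the $C^*$-subalgebra generated by the $c_i$ with $i\in\mathbb{Z}_L$ (resp. $i\in\mathbb{Z}_R$), and let $\Theta_L$ (resp. $\Theta_R$) be its grading, the involutive $*$-automorphism of it determined by $\Theta_L(c_i)=-c_i$, $i\in\mathbb{Z}_L$ (resp. $\Theta_R(c_i)=-c_i$, $i\in\mathbb{Z}_R$). Let $\alpha_L$ and $\alpha_R$ be $*$-automorphisms of $\mathcal{A}_L$ and $\mathcal{A}_R$ with $\alpha_L\Theta_L=\Theta_L\alpha_L$ and $\alpha_R\Theta_R=\Theta_R\alpha_R$. Then there exists a $*$-automorphism $\alpha_L\otimes_{\mathrm{car}}\alpha_R$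 of $\mathcal{A}_{\mathbb{Z}}$ such that $$(\alpha_L\otimes_{\mathrm{car}}\alpha_R)\Bigl(\sum_k A_kB_k\Bigr)=\sum_k\alpha_L(A_k)\,\alpha_R(B_k)$$ for every finite sum with $A_k\in\mathcal{A}_L$ and $B_k\in\mathcal{A}_R$. -/

import Mathlib

open scoped TensorProduct Topology
open Filter

/-! ### Quantum spin lattice systems -/

/-- A quantum spin lattice system on the lattice `Γ`: a unital C⋆-algebra `A` together with
subalgebras `A(I)` for finite `I ⊆ Γ`, each of them a full matrix algebra, such that
`A(I ∪ J) = A(I) ⊗ A(J)` for disjoint `I`, `J`, and such that the local algebra `⋃ A(I)` is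
norm dense in `A`. -/
structure QuantumSpinSystem (Γ : Type*) [DecidableEq Γ] (A : Type*) [CStarAlgebra A] where
  /-- the subsystem `A(I)` of a finite region `I` -/
  loc : Finset Γ → StarSubalgebra ℂ A
  /-- `A(I)` is ⋆-isomorphic to some full matrix algebra `M_k(ℂ)`, `k ≥ 1`. -/
  loc_matrix : ∀ I : Finset Γ, ∃ k : ℕ, 0 < k ∧
    Nonempty (loc I ≃⋆ₐ[ℂ] Matrix (Fin k) (Fin k) ℂ)
  /-- For disjoint `I`, `J` the map `a ⊗ b ↦ a b` is an isomorphism of algebras from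
  `A(I) ⊗ A(J)` onto `A(I ∪ J)`; in particular `A(I)` and `A(J)` commute. -/
  loc_tensor : ∀ I J : Finset Γ, Disjoint I J →
    ∃ e : (loc I ⊗[ℂ] loc J) ≃ₐ[ℂ] loc (I ∪ J),
      ∀ (a : loc I) (b : loc J), (e (a ⊗ₜ[ℂ] b) : A) = (a : A) * (b : A)
  /-- The local algebra is norm dense. -/
  dense_loc : Dense (⋃ I : Finset Γ, (loc I : Set A))

/-- The subsystem `A(I)` of an arbitrary (possibly infinite) region `I`: the C⋆-subalgebra
generated by all `A(J)`, `J ⊆ I` finite. -/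
noncomputable def QuantumSpinSystem.region {Γ : Type*} [DecidableEq Γ] {A : Type*}
    [CStarAlgebra A] (S : QuantumSpinSystem Γ A) (I : Set Γ) : StarSubalgebra ℂ A :=
  (⨆ J : {J : Finset Γ // (J : Set Γ) ⊆ I}, S.loc J.1).topologicalClosure

/-! ### Fermion lattice systems -/

/-- A (spinless) fermion lattice system on the lattice `Γ`: a nonzero unital C⋆-algebra `A` with
annihilation operators `c i`, `i ∈ Γ`, that satisfy the canonical anticommutation relations,
such that the ⋆-algebra generated by all `c i` (the local algebra) is norm dense in `A`. -/
structure IsFermionSystem {Γ : Type*} [DecidableEq Γ] {A : Type*} [CStarAlgebra A]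
    (c : Γ → A) : Prop where
  one_ne_zero : (1 : A) ≠ 0
  /-- `{c_i⋆, c_j} = δ_{ij} 1` -/
  star_anticomm : ∀ i j, star (c i) * c j + c j * star (c i) = if i = j then 1 else 0
  /-- `{c_i, c_j} = 0` -/
  anticomm : ∀ i j, c i * c j + c j * c i = 0
  /-- `{c_i⋆, c_j⋆} = 0` -/
  star_star_anticomm : ∀ i j, star (c i) * star (c j) + star (c j) * star (c i) = 0
  dense_adjoin : Dense (StarAlgebra.adjoin ℂ (Set.range c) : Set A)

/-- The subsystem `A(I)` of an arbitrary (finite or infinite) region `I`: the C⋆-subalgebra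
generated by `c i`, `i ∈ I`. -/
noncomputable def fermionRegion {Γ : Type*} {A : Type*} [CStarAlgebra A] (c : Γ → A)
    (I : Set Γ) : StarSubalgebra ℂ A :=
  (StarAlgebra.adjoin ℂ (c '' I)).topologicalClosure

theorem mem_fermionRegion {Γ : Type*} {A : Type*} [CStarAlgebra A] (c : Γ → A)
    {I : Set Γ} {i : Γ} (hi : i ∈ I) : c i ∈ fermionRegion c I :=
  StarSubalgebra.le_topologicalClosure _
    (StarAlgebra.subset_adjoin ℂ _ (Set.mem_image_of_mem c hi))

namespace IsFermionSystem

variable {Γ : Type*} [DecidableEq Γ] {A : Type*} [CStarAlgebra A] {c : Γ → A}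

/-- The inner automorphism by the unitary `1 - 2 c_j⋆ c_j` flips the sign of `c_j` and fixes the
other annihilation operators. -/
theorem exists_flip (h : IsFermionSystem c) (j : Γ) :
    ∃ φ : A ≃⋆ₐ[ℂ] A, φ (c j) = -c j ∧ ∀ i, i ≠ j → φ (c i) = c i := by
  have hsq : c j * c j = 0 := by
    have := h.anticomm j j
    rw [← two_smul ℂ (c j * c j)] at this
    exact (smul_eq_zero.mp this).resolve_left two_ne_zero
  have hcar : c j * star (c j) = 1 - star (c j) * c j := by
    have := h.star_anticomm j j
    rw [if_pos rfl] at this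
    exact eq_sub_of_add_eq' this
  have hccc : c j * star (c j) * c j = c j := by
    rw [hcar, sub_mul, one_mul, mul_assoc, hsq, mul_zero, sub_zero]
  set n := star (c j) * c j with hn
  have hnn : n * n = n := by
    rw [hn, mul_assoc, ← mul_assoc (c j), hccc]
  have hns : star n = n := by rw [hn, star_mul, star_star]
  have huu : (1 - 2 * n) * (1 - 2 * n) = 1 := by
    have : (1 - 2 * n) * (1 - 2 * n) = 1 - 4 * n + 4 * (n * n) := by noncomm_ring
    rw [this, hnn]; noncomm_ring
  have hus : star (1 - 2 * n) = 1 - 2 * n := by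
    have : (2 : A) * n = n + n := two_mul n
    rw [this, star_sub, star_add, star_one, hns]
  have hu : (1 - 2 * n) ∈ unitary A := by
    rw [Unitary.mem_iff, hus]; exact ⟨huu, huu⟩
  refine ⟨Unitary.conjStarAlgAut ℂ A ⟨_, hu⟩, ?_, ?_⟩
  · have h1 : n * c j = 0 := by rw [hn, mul_assoc, hsq, mul_zero]
    have h2 : c j * n = c j := by rw [hn, ← mul_assoc, hccc]
    rw [Unitary.conjStarAlgAut_apply]
    change (1 - 2 * n) * c j * star (1 - 2 * n) = _
    rw [hus, sub_mul, mul_assoc 2, h1, mul_zero, sub_zero, one_mul, mul_sub, two_mul, mul_add,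
      h2, mul_one]
    abel
  · intro i hij
    have e1 : c i * star (c j) = -(star (c j) * c i) := by
      have := h.star_anticomm j i
      rw [if_neg (Ne.symm hij)] at this
      exact eq_neg_of_add_eq_zero_right this
    have e2 : c j * c i = -(c i * c j) := eq_neg_of_add_eq_zero_right (h.anticomm i j)
    have h3 : c i * n = n * c i := by
      rw [hn, ← mul_assoc, e1, mul_assoc, e2]; simp [mul_assoc]
    have h4 : (1 - 2 * n) * c i = c i * (1 - 2 * n) := by
      rw [two_mul, sub_mul, mul_sub, add_mul, mul_add, h3, one_mul, mul_one]
    rw [Unitary.conjStarAlgAut_apply]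
    change (1 - 2 * n) * c i * star (1 - 2 * n) = _
    rw [hus, h4, mul_assoc, huu, mul_one]

theorem exists_flip_finset (h : IsFermionSystem c) (s : Finset Γ) :
    ∃ φ : A ≃⋆ₐ[ℂ] A, (∀ i ∈ s, φ (c i) = -c i) ∧ ∀ i, i ∉ s → φ (c i) = c i := by
  induction s using Finset.induction_on with
  | empty => exact ⟨StarAlgEquiv.refl ℂ A, by simp, fun i _ => rfl⟩
  | insert j s hj ih =>
    obtain ⟨φ, h1, h2⟩ := ih
    obtain ⟨ψ, k1, k2⟩ := h.exists_flip j
    refine ⟨φ.trans ψ, ?_, ?_⟩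
    · intro i hi
      rw [StarAlgEquiv.trans_apply]
      rcases Finset.mem_insert.mp hi with rfl | hi
      · rw [h2 _ hj, k1]
      · rw [h1 i hi, map_neg, k2 i (fun e => hj (e ▸ hi))]
    · intro i hi
      rw [Finset.mem_insert, not_or] at hi
      rw [StarAlgEquiv.trans_apply, h2 i hi.2, k2 i hi.1]

/-- Existence of the fermion grading on the whole system. -/
theorem exists_starAlgHom (h : IsFermionSystem c) :
    ∃ Θ : A →⋆ₐ[ℂ] A, ∀ i, Θ (c i) = -c i := by
  choose φ h1 h2 using h.exists_flip_finset
  have hiso : ∀ s a, ‖φ s a‖ = ‖a‖ := fun s a =>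
    NonUnitalStarAlgHom.norm_map (φ s) (φ s).injective a
  have halg : ∀ a ∈ StarAlgebra.adjoin ℂ (Set.range c),
      ∃ b, Tendsto (fun s => φ s a) atTop (𝓝 b) := by
    intro a ha
    induction ha using StarAlgebra.adjoin_induction with
    | mem x hx =>
      obtain ⟨i, rfl⟩ := hx
      refine ⟨-c i, tendsto_const_nhds.congr' ?_⟩
      filter_upwards [eventually_ge_atTop {i}] with s hs
      exact (h1 s i (hs (Finset.mem_singleton_self i))).symm
    | algebraMap r => exact ⟨algebraMap ℂ A r, by simp [AlgHomClass.commutes]⟩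
    | add x y _ _ hx hy =>
      obtain ⟨b, hb⟩ := hx
      obtain ⟨d, hd⟩ := hy
      exact ⟨b + d, by simpa using hb.add hd⟩
    | mul x y _ _ hx hy =>
      obtain ⟨b, hb⟩ := hx
      obtain ⟨d, hd⟩ := hy
      exact ⟨b * d, by simpa using hb.mul hd⟩
    | star x _ hx =>
      obtain ⟨b, hb⟩ := hx
      exact ⟨star b, by simpa [map_star] using hb.star⟩
  have hall : ∀ a, ∃ b, Tendsto (fun s => φ s a) atTop (𝓝 b) := by
    intro a
    apply cauchySeq_tendsto_of_complete
    rw [Metric.cauchySeq_iff']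
    intro ε hε
    obtain ⟨x, hx, hax⟩ := Metric.dense_iff.mp h.dense_adjoin a (ε / 3) (by positivity)
    obtain ⟨b, hb⟩ := halg x hax
    obtain ⟨N, hN⟩ := (Metric.cauchySeq_iff'.mp hb.cauchySeq) (ε / 3) (by positivity)
    refine ⟨N, fun s hs => ?_⟩
    have hd : ∀ t, dist (φ t a) (φ t x) < ε / 3 := fun t => by
      rw [dist_eq_norm, ← map_sub, hiso, ← dist_eq_norm, dist_comm]
      exact hx
    have t1 := dist_triangle4 (φ s a) (φ s x) (φ N x) (φ N a)
    have t2 := hd s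
    have t3 := hd N
    rw [dist_comm] at t3
    have t4 := hN s hs
    linarith
  choose Θ hΘ using hall
  refine ⟨{ toFun := Θ
            map_one' := tendsto_nhds_unique (hΘ 1) (by simp)
            map_mul' := fun x y => tendsto_nhds_unique (hΘ _) (by simpa using (hΘ x).mul (hΘ y))
            map_zero' := tendsto_nhds_unique (hΘ 0) (by simp)
            map_add' := fun x y => tendsto_nhds_unique (hΘ _) (by simpa using (hΘ x).add (hΘ y))
            commutes' := fun r => tendsto_nhds_unique (hΘ _) (by simp [AlgHomClass.commutes])
            map_star' := fun x => tendsto_nhds_unique (hΘ _)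
              (by simpa [map_star] using (hΘ x).star) }, fun i => ?_⟩
  refine tendsto_nhds_unique (hΘ (c i)) (tendsto_const_nhds.congr' ?_)
  filter_upwards [eventually_ge_atTop {i}] with s hs
  exact (h1 s i (hs (Finset.mem_singleton_self i))).symm

/-- Existence of the fermion grading of a region. -/
theorem exists_grading (h : IsFermionSystem c) (I : Set Γ) :
    ∃ Θ : fermionRegion c I ≃⋆ₐ[ℂ] fermionRegion c I, ∀ (i : Γ) (hi : i ∈ I),
      Θ ⟨c i, mem_fermionRegion c hi⟩ = -⟨c i, mem_fermionRegion c hi⟩ := by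
  obtain ⟨Θ, hΘ⟩ := h.exists_starAlgHom
  have hcont : Continuous Θ :=
    AddMonoidHomClass.continuous_of_bound Θ 1 fun x => by
      simpa using NonUnitalStarAlgHom.norm_apply_le Θ x
  have hmem : ∀ x ∈ fermionRegion c I, Θ x ∈ fermionRegion c I := by
    have : fermionRegion c I ≤ (fermionRegion c I).comap Θ := by
      refine StarSubalgebra.topologicalClosure_minimal (StarAlgebra.adjoin_le ?_)
        ((StarSubalgebra.isClosed_topologicalClosure _).preimage hcont)
      rintro _ ⟨i, hi, rfl⟩
      change Θ (c i) ∈ fermionRegion c I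
      rw [hΘ]
      exact neg_mem (mem_fermionRegion c hi)
    exact this
  have hinv : ∀ x, Θ (Θ x) = x := by
    have hadj : ∀ a ∈ StarAlgebra.adjoin ℂ (Set.range c), Θ (Θ a) = a := by
      intro a ha
      induction ha using StarAlgebra.adjoin_induction with
      | mem x hx => obtain ⟨i, rfl⟩ := hx; rw [hΘ, map_neg, hΘ, neg_neg]
      | algebraMap r => simp [AlgHomClass.commutes]
      | add x y _ _ hx hy => rw [map_add, map_add, hx, hy]
      | mul x y _ _ hx hy => rw [map_mul, map_mul, hx, hy]
      | star x _ hx => rw [map_star, map_star, hx]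
    exact congrFun (Continuous.ext_on h.dense_adjoin (hcont.comp hcont) continuous_id hadj)
  let f : fermionRegion c I →⋆ₐ[ℂ] fermionRegion c I :=
    (Θ.comp (fermionRegion c I).subtype).codRestrict _ (fun x => hmem x x.2)
  have hf : f.comp f = .id ℂ _ := by
    ext x
    exact hinv x
  refine ⟨.ofStarAlgHom f f hf hf, fun i hi => ?_⟩
  exact Subtype.ext (hΘ i)

/-- The fermion grading `Θ_I` of the region `I`: the involutive ⋆-automorphism of `A(I)` determined
by `Θ_I (c i) = -c i` for `i ∈ I` (hence also `Θ_I (c i⋆) = -c i⋆`). -/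
noncomputable def grading (h : IsFermionSystem c) (I : Set Γ) :
    fermionRegion c I ≃⋆ₐ[ℂ] fermionRegion c I :=
  (h.exists_grading I).choose

theorem grading_apply (h : IsFermionSystem c) (I : Set Γ) {i : Γ} (hi : i ∈ I) :
    h.grading I ⟨c i, mem_fermionRegion c hi⟩ = -⟨c i, mem_fermionRegion c hi⟩ :=
  (h.exists_grading I).choose_spec i hi

end IsFermionSystem

/-! ### The two halves of the chain and product extensions -/

/-- The left half `{…, -2, -1}` of `ℤ`. -/
def leftHalf : Set ℤ := Set.Iio 0

/-- The right half `{0, 1, 2, …}` of `ℤ`. -/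
def rightHalf : Set ℤ := Set.Ici 0

/-- `α` is a product extension of the automorphisms `αL` of `AL` and `αR` of `AR`:
`α (∑ A_k B_k) = ∑ αL(A_k) αR(B_k)` for all finite sums with `A_k ∈ AL` and `B_k ∈ AR`
(so that `α` restricts to `αL` on `AL` and to `αR` on `AR`). -/
def IsProductExtension {A : Type*} [CStarAlgebra A] {AL AR : StarSubalgebra ℂ A}
    (αL : AL ≃⋆ₐ[ℂ] AL) (αR : AR ≃⋆ₐ[ℂ] AR) (α : A ≃⋆ₐ[ℂ] A) : Prop :=
  ∀ (n : ℕ) (a : Fin n → AL) (b : Fin n → AR),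
    α (∑ k, (a k : A) * (b k : A)) = ∑ k, (αL (a k) : A) * (αR (b k) : A)

/-! It suffices to extend an automorphism `α` of one half `B` to an automorphism of `A` that is the
identity on the other half; the extensions of `αL` and `αR` then compose to the required one
(`IsProductExtension.of_extensions`).

To extend `α`, take the ⋆-subalgebra of `A × A` generated by the pairs `(a, α a)`, `a ∈ B`, and `(b,
b)` with `b` local in the other half. If the two coordinates of each of its elements have equal
norm, its closure is the graph of an automorphism (`exists_starAlgEquiv_of_graph`). An element of it
involves only finitely many sites of the other half, and these lie in a matrix algebra with units `e
i j`. If a faithful representation `π` of `B` commutes with the `e i j`, then `X ↦ ∑ π (X i j) * e i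
j` and the same map for `π ∘ α` are injective ⋆-homomorphisms on the C⋆-algebra `M_n(B)`, hence both
isometric (`IsMatrixUnits.norm_lift`). The pairs of their values at a common `X` contain the
generators above, so the norms agree (`StarSubalgebra.exists_extension`).

For spins, `π` is the inclusion. For fermions, odd elements of `B` anticommute with the other half's
`c j`. A Jordan–Wigner self-adjoint unitary `P`, which implements the grading of the finite region,
repairs this: `π (a₀ + a₁) = a₀ + a₁ P` for `a₀` even and `a₁` odd. Since `α` preserves parity, `a =
π a₀ + π a₁ * P` turns into the same formula for `α a`. -/

/-! ### Automorphisms from isometric graphs -/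

/-- A ⋆-subalgebra of `A × A` whose elements have coordinates of equal norm, and whose two
projections are dense, is contained in the graph of a ⋆-automorphism. -/
theorem exists_starAlgEquiv_of_graph {A : Type*} [CStarAlgebra A] (R : StarSubalgebra ℂ (A × A))
    (hR : ∀ p ∈ R, ‖p.1‖ = ‖p.2‖) (h₁ : Dense (Prod.fst '' (R : Set (A × A))))
    (h₂ : Dense (Prod.snd '' (R : Set (A × A)))) :
    ∃ T : A ≃⋆ₐ[ℂ] A, ∀ p ∈ R, T p.1 = p.2 := by
  set C := R.topologicalClosure with hC
  have hcl : IsClosed (C : Set (A × A)) := R.isClosed_topologicalClosure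
  have hRC : R ≤ C := R.le_topologicalClosure
  have hnorm : ∀ p ∈ C, ‖p.1‖ = ‖p.2‖ := by
    intro p hp
    have hsub : closure (R : Set (A × A)) ⊆ {p | ‖p.1‖ = ‖p.2‖} :=
      closure_minimal hR (isClosed_eq (by fun_prop) (by fun_prop))
    exact hsub hp
  -- The norm of `A × A` is the maximum of the two norms, so on `C` each projection is isometric.
  -- Its range is then closed, and dense by hypothesis. The automorphism is the second projection
  -- after the inverse of the first.
  have key : ∀ f : A × A →⋆ₐ[ℂ] A, (∀ p ∈ C, ‖f p‖ = ‖p‖) →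
      Dense (f '' (R : Set (A × A))) → Function.Bijective (f.comp C.subtype) := by
    intro f hf hd
    have hiso : Isometry (f.comp C.subtype) :=
      AddMonoidHomClass.isometry_of_norm _ fun p => hf p p.2
    refine ⟨hiso.injective, ?_⟩
    have : CompleteSpace C := hcl.completeSpace_coe
    have hr : IsClosed (Set.range (f.comp C.subtype)) := hiso.isClosedEmbedding.isClosed_range
    rw [← Set.range_eq_univ, ← hr.closure_eq]
    refine (hd.mono ?_).closure_eq
    rintro _ ⟨p, hp, rfl⟩
    exact ⟨⟨p, hRC hp⟩, rfl⟩
  have b₁ := key (StarAlgHom.fst ℂ A A) (fun p hp => by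
    change ‖p.1‖ = ‖p‖
    rw [Prod.norm_def, ← hnorm p hp, max_self]) h₁
  have b₂ := key (StarAlgHom.snd ℂ A A) (fun p hp => by
    change ‖p.2‖ = ‖p‖
    rw [Prod.norm_def, hnorm p hp, max_self]) h₂
  refine ⟨(StarAlgEquiv.ofBijective _ b₁).symm.trans (StarAlgEquiv.ofBijective _ b₂),
    fun p hp => ?_⟩
  have : p.1 = StarAlgEquiv.ofBijective _ b₁ ⟨p, hRC hp⟩ := rfl
  rw [StarAlgEquiv.trans_apply, this, StarAlgEquiv.symm_apply_apply]
  rfl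

/-! ### Matrix units -/

/-- `e` is a complete system of matrix units in the ⋆-algebra `A`. -/
structure IsMatrixUnits {n A : Type*} [Fintype n] [DecidableEq n] [Ring A] [StarRing A]
    (e : n → n → A) : Prop where
  mul : ∀ i j k l, e i j * e k l = if j = k then e i l else 0
  star : ∀ i j, star (e i j) = e j i
  sum : ∑ i, e i i = 1

namespace IsMatrixUnits

variable {n A B : Type*} [Fintype n] [DecidableEq n]

/-- The ⋆-homomorphism `X ↦ ∑ π(X i j) e i j` of a matrix algebra over `B`, for a representation
`π` of `B` that commutes with the matrix units `e`. -/
noncomputable def lift [Ring A] [StarRing A] [Algebra ℂ A] [StarModule ℂ A]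
    [Ring B] [StarRing B] [Algebra ℂ B] [StarModule ℂ B]
    {e : n → n → A} (he : IsMatrixUnits e) (π : B →⋆ₐ[ℂ] A)
    (hπ : ∀ b i j, Commute (π b) (e i j)) : CStarMatrix n n B →⋆ₐ[ℂ] A where
  toFun X := ∑ i, ∑ j, π (X i j) * e i j
  map_zero' := by simp
  map_one' := by
    simp only [CStarMatrix.one_apply, apply_ite π, map_one, map_zero, ite_mul, one_mul, zero_mul]
    simp [he.sum]
  map_add' X Y := by simp [add_mul, Finset.sum_add_distrib]
  commutes' r := by
    simp only [CStarMatrix.algebraMap_apply, apply_ite π, map_zero, ite_mul, zero_mul,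
      AlgHomClass.commutes]
    simp [← Finset.mul_sum, he.sum]
  map_mul' X Y := by
    have : ∀ i j k l, π (X i j) * e i j * (π (Y k l) * e k l)
        = if j = k then π (X i j) * π (Y k l) * e i l else 0 := by
      intro i j k l
      rw [mul_assoc, ← mul_assoc (e i j), ← (hπ (Y k l) i j).eq, mul_assoc (π (Y k l)), he.mul,
        ← mul_assoc, mul_ite, mul_zero]
    have hmul : ∀ i l, π ((X * Y) i l) = ∑ j, π (X i j) * π (Y j l) := fun i l => by
      rw [CStarMatrix.mul_apply, map_sum]
      simp only [map_mul]
    rw [Finset.sum_mul]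
    refine Finset.sum_congr rfl fun i _ => ?_
    rw [Finset.sum_mul]
    simp only [hmul, Finset.mul_sum, this, Finset.sum_mul]
    rw [Finset.sum_comm]
    refine Finset.sum_congr rfl fun j _ => ?_
    rw [Finset.sum_comm]
    simp
  map_star' X := by
    simp only [star_sum, star_mul, he.star, ← map_star]
    rw [Finset.sum_comm]
    refine Finset.sum_congr rfl fun i _ => Finset.sum_congr rfl fun j _ => ?_
    rw [(hπ _ _ _).eq, CStarMatrix.star_apply]

variable [CStarAlgebra A] [CStarAlgebra B] {e : n → n → A} (he : IsMatrixUnits e)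
  (π : B →⋆ₐ[ℂ] A) (hπ : ∀ b i j, Commute (π b) (e i j))

theorem lift_apply (X : CStarMatrix n n B) :
    he.lift π hπ X = ∑ i, ∑ j, π (X i j) * e i j := rfl

theorem lift_injective (hinj : Function.Injective π) : Function.Injective (he.lift π hπ) := by
  -- Compressing by matrix units recovers each coefficient of `X`.
  have hrec : ∀ X i j, ∑ k, e k i * he.lift π hπ X * e j k = π (X i j) := by
    intro X i j
    have : ∀ k p q, e k i * (π (X p q) * e p q) * e j k
        = if i = p then if q = j then π (X p q) * e k k else 0 else 0 := by
      intro k p q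
      rw [← mul_assoc, ← (hπ (X p q) k i).eq, mul_assoc (π (X p q)), he.mul, mul_ite, mul_zero,
        ite_mul, zero_mul, mul_assoc, he.mul, mul_ite, mul_zero]
    simp only [lift_apply, Finset.mul_sum, Finset.sum_mul, this]
    simp [← Finset.mul_sum, he.sum]
  intro X Y hXY
  ext i j
  apply hinj
  rw [← hrec, hXY, hrec]

/-- An injective ⋆-homomorphism of C⋆-algebras is isometric, so both norms equal that of `X` in
`M_n(B)`. -/
theorem norm_lift (hinj : Function.Injective π) (π' : B →⋆ₐ[ℂ] A)
    (hπ' : ∀ b i j, Commute (π' b) (e i j)) (hinj' : Function.Injective π')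
    (X : CStarMatrix n n B) : ‖he.lift π hπ X‖ = ‖he.lift π' hπ' X‖ := by
  -- The C⋆-structure on `CStarMatrix n n B` requires an order on `B`.
  let _ := CStarAlgebra.spectralOrder B
  have := CStarAlgebra.spectralOrderedRing B
  rw [NonUnitalStarAlgHom.norm_map _ (he.lift_injective π hπ hinj),
    NonUnitalStarAlgHom.norm_map _ (he.lift_injective π' hπ' hinj')]

end IsMatrixUnits

namespace IsMatrixUnits

/-- The linear span of the matrix units. -/
def span {n A : Type*} [AddCommMonoid A] [Module ℂ A] (e : n → n → A) : Submodule ℂ A :=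
  Submodule.span ℂ (Set.range fun p : n × n => e p.1 p.2)

theorem mem_span {n A : Type*} [AddCommMonoid A] [Module ℂ A] (e : n → n → A) (i j : n) :
    e i j ∈ span e :=
  Submodule.subset_span ⟨(i, j), rfl⟩

variable {n A B : Type*} [Fintype n] [DecidableEq n] [CStarAlgebra A] [CStarAlgebra B]
  {e : n → n → A}

theorem one_mem_span (he : IsMatrixUnits e) : (1 : A) ∈ span e := by
  rw [← he.sum]
  exact sum_mem fun i _ => mem_span e i i

/-- The point is that one matrix `X` serves both representations: for `x = e p q` it has the single
entry `b` at `(p, q)`. -/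
theorem exists_lift_eq (he : IsMatrixUnits e) (π : B →⋆ₐ[ℂ] A)
    (hπ : ∀ b i j, Commute (π b) (e i j)) (π' : B →⋆ₐ[ℂ] A)
    (hπ' : ∀ b i j, Commute (π' b) (e i j)) (b : B) {x : A} (hx : x ∈ span e) :
    ∃ X, he.lift π hπ X = π b * x ∧ he.lift π' hπ' X = π' b * x := by
  have hsingle : ∀ (ρ : B →⋆ₐ[ℂ] A) (hρ : ∀ b i j, Commute (ρ b) (e i j)) (p q : n),
      he.lift ρ hρ (CStarMatrix.ofMatrix (Matrix.single p q b)) = ρ b * e p q := by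
    intro ρ hρ p q
    have : ∀ i j, CStarMatrix.ofMatrix (Matrix.single p q b) i j
        = if p = i then if q = j then b else 0 else 0 := by
      intro i j
      rw [← ite_and]
      rfl
    simp only [lift_apply, this, apply_ite ρ, map_zero, ite_mul, zero_mul]
    simp
  induction hx using Submodule.span_induction with
  | mem x hx =>
    obtain ⟨⟨p, q⟩, rfl⟩ := hx
    exact ⟨_, hsingle π hπ p q, hsingle π' hπ' p q⟩
  | zero => exact ⟨0, by simp, by simp⟩
  | add x y _ _ hx hy =>
    obtain ⟨X, h1, h2⟩ := hx
    obtain ⟨Y, k1, k2⟩ := hy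
    exact ⟨X + Y, by rw [map_add, h1, k1, mul_add], by rw [map_add, h2, k2, mul_add]⟩
  | smul r x _ hx =>
    obtain ⟨X, h1, h2⟩ := hx
    exact ⟨r • X, by rw [map_smul, h1, mul_smul_comm], by rw [map_smul, h2, mul_smul_comm]⟩

end IsMatrixUnits

/-! ### A criterion for extending automorphisms -/

theorem StarAlgebra.exists_mem_adjoin_of_directed {A : Type*} [Ring A] [StarRing A]
    [Algebra ℂ A] [StarModule ℂ A] {ι : Type*} [Nonempty ι] {s : ι → Set A}
    (hs : Directed (· ⊆ ·) s) {x : A} (hx : x ∈ StarAlgebra.adjoin ℂ (⋃ i, s i)) :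
    ∃ i, x ∈ StarAlgebra.adjoin ℂ (s i) := by
  have hdir : Directed (· ≤ ·) fun i => StarAlgebra.adjoin ℂ (s i) :=
    hs.mono_comp _ fun _ _ h => StarAlgebra.adjoin_mono h
  have hle : StarAlgebra.adjoin ℂ (⋃ i, s i) ≤ ⨆ i, StarAlgebra.adjoin ℂ (s i) := by
    refine StarAlgebra.adjoin_le (Set.iUnion_subset fun i => ?_)
    exact (StarAlgebra.subset_adjoin ℂ (s i)).trans
      (le_iSup (fun i => StarAlgebra.adjoin ℂ (s i)) i)
  have := hle hx
  rw [← SetLike.mem_coe, StarSubalgebra.coe_iSup_of_directed hdir] at this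
  exact Set.mem_iUnion.mp this

/-- An automorphism `α` of a C⋆-subalgebra `B` extends to an automorphism of `A` that is the
identity on sets `D i`, if the `D i` are contained in matrix algebras over which `B` can be split
off compatibly with `α`. -/
theorem StarSubalgebra.exists_extension {A : Type*} [CStarAlgebra A] (B : StarSubalgebra ℂ A)
    (hB : IsClosed (B : Set A)) (α : B ≃⋆ₐ[ℂ] B) {ι : Type*} [Nonempty ι] (D : ι → Set A)
    (hD : Directed (· ⊆ ·) D)
    (hdense : Dense (StarAlgebra.adjoin ℂ ((B : Set A) ∪ ⋃ i, D i) : Set A))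
    (H : ∀ i, ∃ (n : Type) (_ : Fintype n) (_ : DecidableEq n) (e : n → n → A) (π : B →⋆ₐ[ℂ] A),
      IsMatrixUnits e ∧ Function.Injective π ∧ (∀ b j k, Commute (π b) (e j k)) ∧
      D i ⊆ IsMatrixUnits.span e ∧
      ∀ a : B, ∃ a₀ a₁ : B, ∃ u ∈ IsMatrixUnits.span e,
        (a : A) = π a₀ + π a₁ * u ∧ (α a : A) = π (α a₀) + π (α a₁) * u) :
    ∃ T : A ≃⋆ₐ[ℂ] A, (∀ a : B, T a = α a) ∧ ∀ i, ∀ b ∈ D i, T b = b := by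
  have := hB
  let graphα : Set (A × A) := Set.range fun a : B => ((a : A), (α a : A))
  let s : ι → Set (A × A) := fun i => graphα ∪ (fun b => (b, b)) '' D i
  have hs : Directed (· ⊆ ·) s := fun i j =>
    (hD i j).imp fun _ h => ⟨Set.union_subset_union_right _ (Set.image_mono h.1),
      Set.union_subset_union_right _ (Set.image_mono h.2)⟩
  have hα_mem : ∀ i (a : B), ((a : A), (α a : A)) ∈ s i := fun i a => .inl ⟨a, rfl⟩
  have hD_mem : ∀ i, ∀ b ∈ D i, (b, b) ∈ s i := fun i b hb => .inr ⟨b, hb, rfl⟩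
  have hsub : ∀ i, s i ⊆ StarAlgebra.adjoin ℂ (⋃ i, s i) := fun i =>
    (Set.subset_iUnion s i).trans (StarAlgebra.subset_adjoin ℂ _)
  have hnorm : ∀ p ∈ StarAlgebra.adjoin ℂ (⋃ i, s i), ‖p.1‖ = ‖p.2‖ := by
    intro p hp
    obtain ⟨i, hi⟩ := StarAlgebra.exists_mem_adjoin_of_directed hs hp
    obtain ⟨n, _, _, e, π, he, hinj, hcomm, hDe, hsplit⟩ := H i
    let π' : B →⋆ₐ[ℂ] A := π.comp (α : B →⋆ₐ[ℂ] B)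
    have hcomm' : ∀ b j k, Commute (π' b) (e j k) := fun b j k => hcomm (α b) j k
    have hinj' : Function.Injective π' := hinj.comp α.injective
    -- The generators, hence all of stage `i`, are pairs of values of the two lifts at a common
    -- matrix.
    have hrange : StarAlgebra.adjoin ℂ (s i) ≤
        ((he.lift π hcomm).prod (he.lift π' hcomm')).range := by
      refine StarAlgebra.adjoin_le ?_
      rintro _ (⟨a, rfl⟩ | ⟨b, hb, rfl⟩)
      · obtain ⟨a₀, a₁, u, hu, h1, h2⟩ := hsplit a
        obtain ⟨X, hX, hX'⟩ := he.exists_lift_eq π hcomm π' hcomm' a₀ he.one_mem_span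
        obtain ⟨Y, hY, hY'⟩ := he.exists_lift_eq π hcomm π' hcomm' a₁ hu
        refine ⟨X + Y, Prod.ext ?_ ?_⟩
        · change he.lift π hcomm (X + Y) = a
          rw [map_add, hX, hY, mul_one, h1]
        · change he.lift π' hcomm' (X + Y) = α a
          rw [map_add, hX', hY', mul_one, h2]
          rfl
      · obtain ⟨X, hX, hX'⟩ := he.exists_lift_eq π hcomm π' hcomm' 1 (hDe hb)
        rw [map_one, one_mul] at hX hX'
        exact ⟨X, Prod.ext hX hX'⟩
    obtain ⟨X, rfl⟩ := hrange hi
    exact he.norm_lift π hcomm hinj π' hcomm' hinj' X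
  -- Either coordinate projection maps the generators onto `B` and the `D i`; for the second one
  -- this uses the surjectivity of `α`.
  have hdense' : ∀ f : A × A →⋆ₐ[ℂ] A, (∀ a : B, ∃ a' : B, f ((a' : A), (α a' : A)) = a) →
      (∀ b, f (b, b) = b) → Dense (f '' (StarAlgebra.adjoin ℂ (⋃ i, s i) : Set (A × A))) := by
    intro f hf hf'
    refine hdense.mono ?_
    change _ ≤ (StarAlgebra.adjoin ℂ (⋃ i, s i)).map f
    refine StarAlgebra.adjoin_le (Set.union_subset ?_ (Set.iUnion_subset fun i => ?_))
    · intro a ha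
      obtain ⟨a', ha'⟩ := hf ⟨a, ha⟩
      exact ⟨_, hsub (Classical.arbitrary ι) (hα_mem _ a'), ha'⟩
    · intro b hb
      exact ⟨_, hsub i (hD_mem i b hb), hf' b⟩
  obtain ⟨T, hT⟩ := exists_starAlgEquiv_of_graph _ hnorm
    (hdense' (StarAlgHom.fst ℂ A A) (fun a => ⟨a, rfl⟩) fun _ => rfl)
    (hdense' (StarAlgHom.snd ℂ A A) (fun a => ⟨α.symm a, congrArg Subtype.val
      (α.apply_symm_apply a)⟩) fun _ => rfl)
  exact ⟨T, fun a => hT _ (hsub (Classical.arbitrary ι) (hα_mem _ a)),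
    fun i b hb => hT _ (hsub i (hD_mem i b hb))⟩

/-- Automorphisms that extend `αL`, `αR` and fix the other half compose to a product extension. -/
theorem IsProductExtension.of_extensions {A : Type*} [CStarAlgebra A] {AL AR : StarSubalgebra ℂ A}
    {αL : AL ≃⋆ₐ[ℂ] AL} {αR : AR ≃⋆ₐ[ℂ] AR} {S T : A ≃⋆ₐ[ℂ] A}
    (hS : ∀ a : AL, S a = αL a) (hS' : ∀ b ∈ AR, S b = b)
    (hT : ∀ b : AR, T b = αR b) (hT' : ∀ a ∈ AL, T a = a) :
    IsProductExtension αL αR (S.trans T) := by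
  intro n a b
  simp only [map_sum, map_mul, StarAlgEquiv.trans_apply, hS, hS' _ (b _).2, hT, hT' _ (αL _).2]

/-! ### Extension of automorphisms in quantum spin systems -/

theorem StarAlgEquiv.isMatrixUnits {n A : Type*} [Fintype n] [DecidableEq n] [Ring A] [StarRing A]
    [Algebra ℂ A] [StarModule ℂ A] {S : StarSubalgebra ℂ A} (φ : S ≃⋆ₐ[ℂ] Matrix n n ℂ) :
    IsMatrixUnits fun i j => (φ.symm (Matrix.single i j 1) : A) where
  mul i j k l := by
    rw [← MulMemClass.coe_mul, ← map_mul]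
    split_ifs with h
    · subst h
      rw [Matrix.single_mul_single_same, one_mul]
    · rw [Matrix.single_mul_single_of_ne _ _ _ _ h, map_zero, ZeroMemClass.coe_zero]
  star i j := by
    rw [← StarMemClass.coe_star, ← map_star, Matrix.star_eq_conjTranspose,
      Matrix.conjTranspose_single, star_one]
  sum := by
    rw [← AddSubmonoidClass.coe_finsetSum, ← map_sum, Matrix.sum_single_one, map_one,
      OneMemClass.coe_one]

theorem StarAlgEquiv.mem_span_symm_single {n A : Type*} [Fintype n] [DecidableEq n] [Ring A]
    [StarRing A] [Algebra ℂ A] [StarModule ℂ A] {S : StarSubalgebra ℂ A} (φ : S ≃⋆ₐ[ℂ] Matrix n n ℂ) {x : A}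
    (hx : x ∈ S) : x ∈ IsMatrixUnits.span fun i j => (φ.symm (Matrix.single i j 1) : A) := by
  have : x = ∑ i, ∑ j, φ ⟨x, hx⟩ i j • (φ.symm (Matrix.single i j 1) : A) := by
    have h := φ.symm_apply_apply ⟨x, hx⟩
    rw [Matrix.matrix_eq_sum_single (φ ⟨x, hx⟩)] at h
    have h1 := congrArg (Subtype.val) h
    simp only [map_sum, AddSubmonoidClass.coe_finsetSum] at h1
    refine h1.symm.trans ?_
    refine Finset.sum_congr rfl fun i _ => Finset.sum_congr rfl fun j _ => ?_
    rw [← SetLike.val_smul, ← map_smul, Matrix.smul_single, smul_eq_mul, mul_one]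
  rw [this]
  exact sum_mem fun i _ => sum_mem fun j _ => Submodule.smul_mem _ _ (IsMatrixUnits.mem_span _ i j)

namespace QuantumSpinSystem

variable {Γ : Type*} [DecidableEq Γ] {A : Type*} [CStarAlgebra A] (S : QuantumSpinSystem Γ A)

theorem loc_mono {I J : Finset Γ} (h : I ⊆ J) : S.loc I ≤ S.loc J := by
  intro a ha
  obtain ⟨e, he⟩ := S.loc_tensor I (J \ I) Finset.disjoint_sdiff
  have := (e (⟨a, ha⟩ ⊗ₜ 1)).2
  rw [he, OneMemClass.coe_one, mul_one] at this
  rwa [Finset.union_sdiff_of_subset h] at this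

theorem loc_commute {I J : Finset Γ} (h : Disjoint I J) {a b : A} (ha : a ∈ S.loc I)
    (hb : b ∈ S.loc J) : Commute a b := by
  obtain ⟨e, he⟩ := S.loc_tensor I J h
  have h1 := he ⟨a, ha⟩ 1
  have h2 := he 1 ⟨b, hb⟩
  rw [OneMemClass.coe_one, mul_one] at h1
  rw [OneMemClass.coe_one, one_mul] at h2
  change (⟨a, ha⟩ : S.loc I).1 * (⟨b, hb⟩ : S.loc J).1
    = (⟨b, hb⟩ : S.loc J).1 * (⟨a, ha⟩ : S.loc I).1
  rw [← h1, ← h2, ← MulMemClass.coe_mul, ← MulMemClass.coe_mul, ← map_mul, ← map_mul]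
  simp

theorem loc_union_le {I J : Finset Γ} (h : Disjoint I J) {T : StarSubalgebra ℂ A}
    (hI : S.loc I ≤ T) (hJ : S.loc J ≤ T) : S.loc (I ∪ J) ≤ T := by
  intro a ha
  obtain ⟨e, he⟩ := S.loc_tensor I J h
  obtain ⟨t, ht⟩ := e.surjective ⟨a, ha⟩
  have hat : a = e t := by rw [ht]
  rw [hat]
  clear ht hat
  induction t with
  | zero => simp
  | tmul a b =>
    rw [he]
    exact mul_mem (hI a.2) (hJ b.2)
  | add x y hx hy =>
    rw [map_add]
    exact add_mem hx hy

theorem loc_le_region {I : Set Γ} {J : Finset Γ} (h : (J : Set Γ) ⊆ I) :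
    S.loc J ≤ S.region I :=
  (le_iSup (fun J : {J : Finset Γ // (J : Set Γ) ⊆ I} => S.loc J.1) ⟨J, h⟩).trans
    (StarSubalgebra.le_topologicalClosure _)

theorem region_le {I : Set Γ} {T : StarSubalgebra ℂ A} (hT : IsClosed (T : Set A))
    (h : ∀ J : Finset Γ, (J : Set Γ) ⊆ I → S.loc J ≤ T) : S.region I ≤ T :=
  StarSubalgebra.topologicalClosure_minimal (iSup_le fun J => h J.1 J.2) hT

/-- Centralizers of ⋆-closed sets are closed ⋆-subalgebras, so commutation passes from local
algebras to the region. -/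
theorem region_commute_loc {I : Set Γ} {J : Finset Γ} (h : Disjoint I J) {a b : A}
    (ha : a ∈ S.region I) (hb : b ∈ S.loc J) : Commute a b := by
  have hle : S.region I ≤ StarSubalgebra.centralizer ℂ (S.loc J : Set A) := by
    refine S.region_le ?_ fun K hK x hx => ?_
    · rw [StarSubalgebra.coe_centralizer]
      exact Set.isClosed_centralizer _
    · rw [StarSubalgebra.mem_centralizer_iff]
      have hd : Disjoint K J := by
        rw [← Finset.disjoint_coe]
        exact h.mono_left hK
      exact fun y hy => ⟨(S.loc_commute hd hx hy).eq.symm,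
        (S.loc_commute hd hx (star_mem hy)).eq.symm⟩
  exact (((StarSubalgebra.mem_centralizer_iff ℂ).mp (hle ha)) b hb).1.symm

/-- An automorphism of `A(I)` extends to an automorphism of the whole system that is the identity
on the complementary region. -/
theorem exists_extension (I : Set Γ) (α : S.region I ≃⋆ₐ[ℂ] S.region I) :
    ∃ T : A ≃⋆ₐ[ℂ] A, (∀ a : S.region I, T a = α a) ∧ ∀ b ∈ S.region Iᶜ, T b = b := by
  classical
  obtain ⟨T, hT, hT'⟩ : ∃ T : A ≃⋆ₐ[ℂ] A, (∀ a : S.region I, T a = α a) ∧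
      ∀ J : Finset Γ, ∀ b ∈ (S.loc (J.filter (· ∉ I)) : Set A), T b = b := by
    refine StarSubalgebra.exists_extension (S.region I)
      (StarSubalgebra.isClosed_topologicalClosure _) α
      (fun J : Finset Γ => (S.loc (J.filter (· ∉ I)) : Set A)) ?_ ?_ ?_
    · intro J K
      exact ⟨J ∪ K, S.loc_mono (Finset.filter_subset_filter _ Finset.subset_union_left),
        S.loc_mono (Finset.filter_subset_filter _ Finset.subset_union_right)⟩
    · refine S.dense_loc.mono (Set.iUnion_subset fun J => ?_)
      have hJ : J = J.filter (· ∈ I) ∪ J.filter (· ∉ I) := (Finset.filter_union_filter_not_eq _ J).symm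
      change S.loc J ≤ _
      rw [hJ]
      refine S.loc_union_le (Finset.disjoint_filter_filter_not _ _ _) ?_ ?_
      · refine (S.loc_le_region fun x hx => (Finset.mem_filter.mp hx).2).trans ?_
        exact fun x hx => StarAlgebra.subset_adjoin ℂ _ (.inl hx)
      · exact fun x hx => StarAlgebra.subset_adjoin ℂ _ (.inr (Set.mem_iUnion.mpr ⟨J, hx⟩))
    · intro J
      obtain ⟨k, -, ⟨φ⟩⟩ := S.loc_matrix (J.filter (· ∉ I))
      -- The two regions commute, so the inclusion serves as `π` and the splitting is the trivial `a
      -- = a + 0 * 0`.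
      refine ⟨Fin k, inferInstance, inferInstance, _, (S.region I).subtype, φ.isMatrixUnits,
        Subtype.val_injective, fun b i j => S.region_commute_loc ?_ b.2 (Subtype.property _),
        fun x hx => φ.mem_span_symm_single hx, fun a => ⟨a, 0, 0, zero_mem _, ?_, ?_⟩⟩
      · rw [Set.disjoint_left]
        exact fun x hx hx' => (Finset.mem_filter.mp hx').2 hx
      · simp
      · simp
  refine ⟨T, hT, ?_⟩
  have hTc : Continuous T := (StarAlgEquiv.isometry T).continuous
  have := S.region_le (I := Iᶜ) (T := StarAlgHom.equalizer (T : A →⋆ₐ[ℂ] A) (.id ℂ A))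
    (isClosed_eq hTc continuous_id) fun J hJ b hb => hT' J b (by
      rwa [SetLike.mem_coe, Finset.filter_true_of_mem (p := (· ∉ I)) fun x hx => hJ hx])
  exact this

end QuantumSpinSystem

/-! ### Matrix units for fermions -/

namespace IsMatrixUnits

variable {n m A : Type*} [Ring A] {e : n → n → A} {f : m → m → A}

theorem prod [Fintype n] [DecidableEq n] [Fintype m] [DecidableEq m] [StarRing A] (he : IsMatrixUnits e) (hf : IsMatrixUnits f)
    (hef : ∀ i j k l, Commute (e i j) (f k l)) :
    IsMatrixUnits fun p q : n × m => e p.1 q.1 * f p.2 q.2 where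
  mul p q r s := by
    rw [mul_assoc, ← mul_assoc (f _ _), ← (hef _ _ _ _).eq, mul_assoc, ← mul_assoc (e _ _), he.mul,
      hf.mul]
    split_ifs <;> simp_all [Prod.ext_iff]
  star p q := by rw [star_mul, he.star, hf.star, (hef _ _ _ _).eq]
  sum := by
    rw [Fintype.sum_prod_type]
    simp only [← Finset.mul_sum, hf.sum, mul_one, he.sum]

theorem mul_mem_span_prod [Algebra ℂ A] {x : A} (hx : x ∈ span e) (k l : m) :
    x * f k l ∈ span fun p q : n × m => e p.1 q.1 * f p.2 q.2 := by
  induction hx using Submodule.span_induction with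
  | mem x hx =>
    obtain ⟨⟨i, j⟩, rfl⟩ := hx
    exact mem_span (fun p q : n × m => e p.1 q.1 * f p.2 q.2) (i, k) (j, l)
  | zero => rw [zero_mul]; exact zero_mem _
  | add x y _ _ hx hy => rw [add_mul]; exact add_mem hx hy
  | smul r x _ hx => rw [smul_mul_assoc]; exact Submodule.smul_mem _ _ hx

end IsMatrixUnits

/-- The `2 × 2` matrix units generated by an annihilation operator `d`. -/
def fermionUnits {A : Type*} [Mul A] [Star A] (d : A) : Bool → Bool → A
  | false, false => d * star d
  | false, true => d
  | true, false => star d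
  | true, true => star d * d

theorem isMatrixUnits_fermionUnits {A : Type*} [Ring A] [StarRing A] {d : A} (hd : d * d = 0)
    (hd' : d * star d + star d * d = 1) : IsMatrixUnits (fermionUnits d) where
  mul i j k l := by
    have h1 : star d * star d = 0 := by rw [← star_mul, hd, star_zero]
    have h2 : d * star d * d = d := by
      have := congrArg (· * d) hd'
      simpa [add_mul, mul_assoc, hd] using this
    have h3 : star d * d * star d = star d := by
      simpa [mul_assoc] using congrArg star h2
    have h2' : d * (star d * d) = d := by rw [← mul_assoc, h2]
    have h3' : star d * (d * star d) = star d := by rw [← mul_assoc, h3]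
    have h4 : ∀ x, d * (d * x) = 0 := fun x => by rw [← mul_assoc, hd, zero_mul]
    have h5 : ∀ x, star d * (star d * x) = 0 := fun x => by rw [← mul_assoc, h1, zero_mul]
    cases i <;> cases j <;> cases k <;> cases l <;>
      simp [fermionUnits, mul_assoc, hd, h1, h2', h3', h4, h5]
  star i j := by cases i <;> cases j <;> simp [fermionUnits]
  sum := by rw [Fintype.sum_bool, ← hd', add_comm]; rfl

/-- Useful for properties not visibly stable under `star`, such as `c j * a = Θ a * c j`: only
generators and their adjoints need checking. -/
theorem StarAlgebra.adjoin_induction_star_generators {A : Type*} [Ring A] [StarRing A]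
    [Algebra ℂ A] [StarModule ℂ A] {s : Set A} {p : A → Prop} (mem : ∀ x ∈ s, p x)
    (mem_star : ∀ x ∈ s, p (star x)) (algebraMap : ∀ r : ℂ, p (algebraMap ℂ A r))
    (add : ∀ x y, p x → p y → p (x + y)) (mul : ∀ x y, p x → p y → p (x * y))
    {a : A} (ha : a ∈ StarAlgebra.adjoin ℂ s) : p a := by
  rw [← StarSubalgebra.mem_toSubalgebra, StarAlgebra.adjoin_toSubalgebra] at ha
  induction ha using Algebra.adjoin_induction with
  | mem x hx =>
    rcases hx with hx | hx
    · exact mem x hx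
    · simpa using mem_star _ hx
  | algebraMap r => exact algebraMap r
  | add x y _ _ hx hy => exact add x y hx hy
  | mul x y _ _ hx hy => exact mul x y hx hy

namespace IsFermionSystem

variable {Γ : Type*} [DecidableEq Γ] {A : Type*} [CStarAlgebra A] {c : Γ → A}

theorem mul_self (h : IsFermionSystem c) (j : Γ) : c j * c j = 0 := by
  have := h.anticomm j j
  rw [← two_smul ℂ (c j * c j)] at this
  exact (smul_eq_zero.mp this).resolve_left two_ne_zero

theorem semiconjBy (h : IsFermionSystem c) (i j : Γ) : SemiconjBy (c i) (c j) (-c j) := by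
  rw [SemiconjBy, neg_mul]
  exact eq_neg_of_add_eq_zero_left (h.anticomm i j)

theorem star_semiconjBy (h : IsFermionSystem c) {i j : Γ} (hij : i ≠ j) :
    SemiconjBy (star (c i)) (c j) (-c j) := by
  have := h.star_anticomm i j
  rw [if_neg hij] at this
  rw [SemiconjBy, neg_mul]
  exact eq_neg_of_add_eq_zero_left this

theorem semiconjBy_star (h : IsFermionSystem c) {i j : Γ} (hij : i ≠ j) :
    SemiconjBy (c i) (star (c j)) (-star (c j)) := by
  have := h.star_anticomm j i
  rw [if_neg hij.symm] at this
  rw [SemiconjBy, neg_mul]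
  exact eq_neg_of_add_eq_zero_right this

theorem mul_star_add (h : IsFermionSystem c) (j : Γ) :
    c j * star (c j) + star (c j) * c j = 1 := by
  rw [add_comm, h.star_anticomm, if_pos rfl]

/-- The local algebra of a finite region has matrix units (by the Jordan–Wigner transformation),
and it contains a self-adjoint unitary `P` implementing its grading. -/
theorem exists_isMatrixUnits (h : IsFermionSystem c) (J : Finset Γ) :
    ∃ (n : Type) (_ : Fintype n) (_ : DecidableEq n) (e : n → n → A) (P : A),
      IsMatrixUnits e ∧ (∀ p q, e p q ∈ StarAlgebra.adjoin ℂ (c '' J)) ∧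
      (∀ j ∈ J, c j ∈ IsMatrixUnits.span e) ∧ P ∈ IsMatrixUnits.span e ∧
      star P = P ∧ P * P = 1 ∧ (∀ Θ : A →⋆ₐ[ℂ] A, (∀ i, Θ (c i) = -c i) → Θ P = P) ∧
      (∀ i ∈ J, P * c i = -(c i * P)) ∧ ∀ i, i ∉ J → P * c i = c i * P := by
  induction J using Finset.induction_on with
  | empty =>
    refine ⟨Unit, inferInstance, inferInstance, fun _ _ => 1, 1, ⟨by simp, by simp, by simp⟩,
      fun _ _ => one_mem _, by simp, IsMatrixUnits.mem_span (fun _ _ : Unit => (1 : A)) () (),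
      by simp, by simp, by simp, by simp, by simp⟩
  | insert j J hj ih =>
    obtain ⟨n, _, _, e, P, he, he_mem, hce, hPe, hPs, hPP, hΘ, hPJ, hPJ'⟩ := ih
    -- Jordan–Wigner step: `d = P * c j` is again an annihilation operator, and it commutes with the
    -- old units. The new unitary is `P * (c j * star (c j) - star (c j) * c j)`, whose second
    -- factor is `1 - 2 c_j⋆ c_j`.
    have hPc := hPJ' j hj
    have hPcs : P * star (c j) = star (c j) * P := by
      simpa [hPs] using (congrArg star hPc).symm
    have hds : star (P * c j) = star (c j) * P := by rw [star_mul, hPs]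
    have hdd : P * c j * (P * c j) = 0 := by
      rw [Commute.mul_mul_mul_comm (Commute.symm hPc), hPP, one_mul, h.mul_self]
    have hn₀ : P * c j * star (P * c j) = c j * star (c j) := by
      rw [hds, ← hPcs, Commute.mul_mul_mul_comm (Commute.symm hPc), hPP, one_mul]
    have hn₁ : star (P * c j) * (P * c j) = star (c j) * c j := by
      rw [hds, mul_assoc, ← mul_assoc P, hPP, one_mul]
    have hf := isMatrixUnits_fermionUnits hdd (by rw [hn₀, hn₁, h.mul_star_add])
    have hne : ∀ i ∈ J, i ≠ j := fun i hi => ne_of_mem_of_not_mem hi hj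
    -- The signs from moving `c i` past `c j` and past `P` cancel.
    have hcomm : ∀ i ∈ J, Commute (P * c j) (c i) := fun i hi => by
      have h1 : SemiconjBy P (-c i) (c i) := by simp [SemiconjBy, hPJ i hi]
      exact h1.mul_left (h.semiconjBy j i)
    have hcomm_star : ∀ i ∈ J, Commute (P * c j) (star (c i)) := fun i hi => by
      have h1 : SemiconjBy P (-star (c i)) (star (c i)) := by
        have := congrArg star (hPJ i hi)
        simp only [star_mul, hPs, star_neg] at this
        simp [SemiconjBy, this]
      exact h1.mul_left (h.semiconjBy_star (hne i hi).symm)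
    have hed : ∀ p q, e p q ∈ StarSubalgebra.centralizer ℂ {P * c j} := fun p q => by
      refine StarAlgebra.adjoin_le ?_ (he_mem p q)
      rintro _ ⟨i, hi, rfl⟩
      rw [SetLike.mem_coe, StarSubalgebra.mem_centralizer_iff]
      rintro _ rfl
      exact ⟨hcomm i hi, by simpa using (hcomm_star i hi).star_star.eq⟩
    have hef : ∀ p q k l, Commute (e p q) (fermionUnits (P * c j) k l) := by
      intro p q k l
      have h1 : Commute (e p q) (P * c j) :=
        ((StarSubalgebra.mem_centralizer_iff ℂ).mp (hed p q) _ rfl).1.symm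
      have h2 : Commute (e p q) (star (P * c j)) :=
        ((StarSubalgebra.mem_centralizer_iff ℂ).mp (hed p q) _ rfl).2.symm
      cases k <;> cases l
      exacts [h1.mul_right h2, h1, h2, h2.mul_right h1]
    have he_mem' : ∀ p q, e p q ∈ StarAlgebra.adjoin ℂ (c '' ↑(insert j J)) := fun p q =>
      StarAlgebra.adjoin_mono (Set.image_mono (by simp)) (he_mem p q)
    have hspan : ∀ x ∈ IsMatrixUnits.span e, x ∈ IsMatrixUnits.span fun p q : n × Bool =>
        e p.1 q.1 * fermionUnits (P * c j) p.2 q.2 := fun x hx => by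
      rw [← mul_one x, ← hf.sum, Finset.mul_sum]
      exact sum_mem fun k _ => IsMatrixUnits.mul_mem_span_prod hx k k
    have hspan_le : ∀ x ∈ IsMatrixUnits.span e, x ∈ StarAlgebra.adjoin ℂ (c '' ↑(insert j J)) :=
      fun x hx => by
        have : IsMatrixUnits.span e ≤ (StarAlgebra.adjoin ℂ
            (c '' ↑(insert j J))).toSubalgebra.toSubmodule :=
          Submodule.span_le.mpr (by rintro _ ⟨p, rfl⟩; exact he_mem' _ _)
        exact this hx
    have hdj : P * c j ∈ StarAlgebra.adjoin ℂ (c '' ↑(insert j J)) :=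
      mul_mem (hspan_le P hPe) (StarAlgebra.subset_adjoin ℂ _ ⟨j, by simp, rfl⟩)
    have hPn : P * (c j * star (c j) - star (c j) * c j)
        = (c j * star (c j) - star (c j) * c j) * P :=
      ((Commute.mul_right hPc hPcs).sub_right (Commute.mul_right hPcs hPc)).eq
    have hn_comm : ∀ i, i ≠ j → SemiconjBy (c j * star (c j) - star (c j) * c j) (c i) (c i) :=
      fun i hi => by
        have h1 := h.semiconjBy j i
        have h2 := h.star_semiconjBy hi.symm
        refine SemiconjBy.sub_left ?_ ?_
        · simpa using h1.neg_right.mul_left h2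
        · simpa using h2.neg_right.mul_left h1
    have hnc : (c j * star (c j) - star (c j) * c j) * c j = c j := by
      have := congrArg (c j * ·) (h.mul_star_add j)
      simp only [mul_add, ← mul_assoc, h.mul_self, zero_mul, zero_add, mul_one] at this
      rw [sub_mul, this, mul_assoc, h.mul_self, mul_zero, sub_zero]
    have hcn : c j * (c j * star (c j) - star (c j) * c j) = -c j := by
      have := congrArg (c j * ·) (h.mul_star_add j)
      simp only [mul_add, ← mul_assoc, h.mul_self, zero_mul, zero_add, mul_one] at this
      rw [mul_sub, ← mul_assoc, ← mul_assoc, this, h.mul_self, zero_mul, zero_sub]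
    have hn_star : star (c j * star (c j) - star (c j) * c j)
        = c j * star (c j) - star (c j) * c j := by
      rw [star_sub, star_mul, star_star, star_mul, star_star]
    have hns : (c j * star (c j) - star (c j) * c j) * star (c j) = -star (c j) := by
      rw [← hn_star, ← star_mul, hcn, star_neg]
    refine ⟨n × Bool, inferInstance, inferInstance, _,
      P * (c j * star (c j) - star (c j) * c j), he.prod hf hef, ?_, ?_, ?_, ?_, ?_, ?_, ?_, ?_⟩
    · rintro ⟨p, k⟩ ⟨q, l⟩
      refine mul_mem (he_mem' p q) ?_
      cases k <;> cases l
      exacts [mul_mem hdj (star_mem hdj), hdj, star_mem hdj, mul_mem (star_mem hdj) hdj]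
    · intro i hi
      rcases Finset.mem_insert.mp hi with rfl | hi
      · have := IsMatrixUnits.mul_mem_span_prod (f := fermionUnits (P * c i)) hPe false true
        rwa [show P * fermionUnits (P * c i) false true = c i by
          rw [fermionUnits, ← mul_assoc, hPP, one_mul]] at this
      · exact hspan _ (hce i hi)
    · rw [← hn₀, ← hn₁, mul_sub]
      exact sub_mem (IsMatrixUnits.mul_mem_span_prod (f := fermionUnits (P * c j)) hPe false false)
        (IsMatrixUnits.mul_mem_span_prod (f := fermionUnits (P * c j)) hPe true true)
    · rw [star_mul, hPs, hn_star, hPn]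
    · rw [Commute.mul_mul_mul_comm hPn.symm, hPP, one_mul, mul_sub, ← mul_assoc, hnc, ← mul_assoc,
        hns, neg_mul, sub_neg_eq_add, h.mul_star_add]
    · intro Θ hc
      rw [map_mul, hΘ Θ hc, map_sub, map_mul, map_mul, map_star, hc]
      simp
    · intro i hi
      rcases Finset.mem_insert.mp hi with rfl | hi
      · rw [mul_assoc, hnc, hPn, ← mul_assoc, hcn, neg_mul, neg_neg, hPc]
      · have h1 : SemiconjBy P (c i) (-c i) := by simp [SemiconjBy, hPJ i hi]
        simpa [SemiconjBy] using h1.mul_left (hn_comm i (hne i hi))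
    · intro i hi
      rw [Finset.mem_insert, not_or] at hi
      have h1 : SemiconjBy P (c i) (c i) := hPJ' i hi.2
      exact h1.mul_left (hn_comm i hi.1)

end IsFermionSystem

/-! ### Extension of automorphisms in fermion systems -/

/-- Two representations `ρ`, `σ` of `B` glued along a projection `q` commuting with both. -/
def StarAlgHom.glue {A B : Type*} [Ring A] [StarRing A] [Algebra ℂ A] [Ring B] [StarRing B]
    [Algebra ℂ B] (ρ σ : B →⋆ₐ[ℂ] A) {q : A} (hqs : star q = q) (hqq : q * q = q)
    (hρ : ∀ b, Commute q (ρ b)) (hσ : ∀ b, Commute q (σ b)) : B →⋆ₐ[ℂ] A where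
  toFun b := ρ b * q + σ b * (1 - q)
  map_zero' := by simp
  map_one' := by simp
  map_add' x y := by
    rw [map_add, map_add, add_mul, add_mul]
    abel
  map_mul' x y := by
    have hq' : q * (1 - q) = 0 := by rw [mul_sub, mul_one, hqq, sub_self]
    have hq'' : (1 - q) * q = 0 := by rw [sub_mul, one_mul, hqq, sub_self]
    have hqq' : (1 - q) * (1 - q) = 1 - q := by rw [mul_sub, mul_one, hq'', sub_zero]
    have h1 : Commute (1 - q) (σ y) := (Commute.one_left _).sub_left (hσ y)
    have h2 : Commute (1 - q) (ρ y) := (Commute.one_left _).sub_left (hρ y)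
    rw [map_mul, map_mul, add_mul, mul_add, mul_add, (hρ y).mul_mul_mul_comm,
      h1.mul_mul_mul_comm, h2.mul_mul_mul_comm, (hσ y).mul_mul_mul_comm, hqq, hqq', hq', hq'']
    simp
  commutes' r := by
    rw [AlgHomClass.commutes, AlgHomClass.commutes, ← mul_add]
    simp
  map_star' x := by
    have h1 : Commute (1 - q) (star (σ x)) := by
      rw [← map_star]
      exact (Commute.one_left _).sub_left (hσ _)
    have h2 : Commute q (star (ρ x)) := by
      rw [← map_star]
      exact hρ _
    rw [star_add, star_mul, star_mul, star_sub, star_one, hqs, h1.eq, h2.eq, map_star, map_star]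

theorem fermionRegion_le {Γ : Type*} {A : Type*} [CStarAlgebra A] {c : Γ → A} {I : Set Γ}
    {T : StarSubalgebra ℂ A} (hT : IsClosed (T : Set A)) (h : ∀ i ∈ I, c i ∈ T) :
    fermionRegion c I ≤ T :=
  StarSubalgebra.topologicalClosure_minimal
    (StarAlgebra.adjoin_le (by rintro _ ⟨i, hi, rfl⟩; exact h i hi)) hT

theorem StarAlgHom.continuous_of_cstarAlgebra {A B : Type*} [CStarAlgebra A] [CStarAlgebra B]
    (f : A →⋆ₐ[ℂ] B) : Continuous f :=
  AddMonoidHomClass.continuous_of_bound f 1 fun x => by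
    simpa using NonUnitalStarAlgHom.norm_apply_le f x

namespace IsFermionSystem

variable {Γ : Type*} [DecidableEq Γ] {A : Type*} [CStarAlgebra A] {c : Γ → A}

theorem starAlgHom_involutive (h : IsFermionSystem c) {Θ : A →⋆ₐ[ℂ] A} (hΘ : ∀ i, Θ (c i) = -c i) :
    Function.Involutive Θ := by
  have hc := Θ.continuous_of_cstarAlgebra
  have hle : StarAlgebra.adjoin ℂ (Set.range c) ≤
      StarAlgHom.equalizer (Θ.comp Θ) (StarAlgHom.id ℂ A) := by
    refine StarAlgebra.adjoin_le ?_
    rintro _ ⟨i, rfl⟩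
    change Θ (Θ (c i)) = c i
    rw [hΘ, map_neg, hΘ, neg_neg]
  exact congrFun (Continuous.ext_on h.dense_adjoin (hc.comp hc) continuous_id hle)

/-- Two continuous ⋆-homomorphisms agreeing on the generators `c i` coincide; this ties the chosen
grading of a region to the global `Θ`. -/
theorem coe_grading (h : IsFermionSystem c) (I : Set Γ) {Θ : A →⋆ₐ[ℂ] A}
    (hΘ : ∀ i, Θ (c i) = -c i) (a : fermionRegion c I) : (h.grading I a : A) = Θ a := by
  have hcl : IsClosed (fermionRegion c I : Set A) := StarSubalgebra.isClosed_topologicalClosure _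
  let f : fermionRegion c I →⋆ₐ[ℂ] A :=
    (fermionRegion c I).subtype.comp (h.grading I : fermionRegion c I →⋆ₐ[ℂ] fermionRegion c I)
  let g : fermionRegion c I →⋆ₐ[ℂ] A := Θ.comp (fermionRegion c I).subtype
  have hf : Continuous f := f.continuous_of_cstarAlgebra
  have hg : Continuous g := g.continuous_of_cstarAlgebra
  have hfg : f = g := by
    refine StarAlgHom.ext_topologicalClosure hf hg ?_
    refine StarAlgHom.ext_adjoin fun x hx => ?_
    obtain ⟨i, hi, hix⟩ := hx
    obtain ⟨x, hx⟩ := x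
    obtain rfl : c i = x := hix
    change (h.grading I ⟨c i, mem_fermionRegion c hi⟩ : A) = Θ (c i)
    rw [h.grading_apply I hi, hΘ]
    rfl
  exact DFunLike.congr_fun hfg a

/-- The relation holds for the generators of the region and their adjoints, and survives products
because `Θ` is multiplicative. -/
theorem mul_eq_grading_mul (h : IsFermionSystem c) {I : Set Γ} {j : Γ} (hj : j ∉ I)
    {Θ : A →⋆ₐ[ℂ] A} (hΘ : ∀ i, Θ (c i) = -c i) {a : A} (ha : a ∈ fermionRegion c I) :
    c j * a = Θ a * c j := by
  have hc := Θ.continuous_of_cstarAlgebra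
  have hcl : IsClosed {a : A | c j * a = Θ a * c j} := isClosed_eq (by fun_prop) (by fun_prop)
  refine closure_minimal (fun a ha => ?_) hcl ha
  refine StarAlgebra.adjoin_induction_star_generators (p := fun a => c j * a = Θ a * c j)
    ?_ ?_ (fun r => ?_) (fun x y hx hy => ?_) (fun x y hx hy => ?_) ha
  · rintro _ ⟨i, hi, rfl⟩
    rw [hΘ]
    exact h.semiconjBy j i
  · rintro _ ⟨i, hi, rfl⟩
    rw [map_star, hΘ, star_neg]
    exact h.semiconjBy_star (ne_of_mem_of_not_mem hi hj).symm
  · rw [AlgHomClass.commutes]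
    exact (Algebra.commutes r _).symm
  · rw [map_add, mul_add, add_mul, hx, hy]
  · rw [map_mul, ← mul_assoc, hx, mul_assoc, hy, mul_assoc]

/-- An automorphism of `A(I)` that commutes with the grading extends to an automorphism of the
whole system that is the identity on the complementary region. -/
theorem exists_extension (h : IsFermionSystem c) (I : Set Γ)
    (α : fermionRegion c I ≃⋆ₐ[ℂ] fermionRegion c I)
    (hα : ∀ a, α (h.grading I a) = h.grading I (α a)) :
    ∃ T : A ≃⋆ₐ[ℂ] A, (∀ a : fermionRegion c I, T a = α a) ∧
      ∀ b ∈ fermionRegion c Iᶜ, T b = b := by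
  classical
  obtain ⟨Θ, hΘ⟩ := h.exists_starAlgHom
  have hΘΘ := h.starAlgHom_involutive hΘ
  have hg := h.coe_grading I hΘ
  obtain ⟨T, hT, hT'⟩ : ∃ T : A ≃⋆ₐ[ℂ] A, (∀ a : fermionRegion c I, T a = α a) ∧
      ∀ J : Finset Γ, ∀ b ∈ c '' (J.filter (· ∉ I)), T b = b := by
    refine StarSubalgebra.exists_extension (fermionRegion c I)
      (StarSubalgebra.isClosed_topologicalClosure _) α
      (fun J : Finset Γ => c '' (J.filter (· ∉ I))) ?_ ?_ ?_
    · intro J K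
      exact ⟨J ∪ K,
        Set.image_mono (Finset.coe_subset.mpr
          (Finset.filter_subset_filter _ Finset.subset_union_left)),
        Set.image_mono (Finset.coe_subset.mpr
          (Finset.filter_subset_filter _ Finset.subset_union_right))⟩
    · refine h.dense_adjoin.mono (StarAlgebra.adjoin_mono ?_)
      rintro _ ⟨i, rfl⟩
      by_cases hi : i ∈ I
      · exact .inl (mem_fermionRegion c hi)
      · exact .inr (Set.mem_iUnion.mpr ⟨{i}, i, by simpa using hi, rfl⟩)
    · intro J
      obtain ⟨n, hn, hn', e, P, he, he_mem, hce, hPe, hPs, hPP, hΘP, hPJ, hPJ'⟩ :=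
        h.exists_isMatrixUnits (J.filter (· ∉ I))
      have hPI : ∀ a ∈ fermionRegion c I, Commute P a := by
        have hle : fermionRegion c I ≤ StarSubalgebra.centralizer ℂ {P} := by
          refine fermionRegion_le ?_ fun i hi => ?_
          · rw [StarSubalgebra.coe_centralizer]
            exact Set.isClosed_centralizer _
          · rw [StarSubalgebra.mem_centralizer_iff]
            rintro _ rfl
            have := hPJ' i fun hi' => (Finset.mem_filter.mp hi').2 hi
            rw [hPs]
            exact ⟨this, this⟩
        exact fun a ha => ((StarSubalgebra.mem_centralizer_iff ℂ).mp (hle ha) P rfl).1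
      -- `q` is the spectral projection of `P` for the eigenvalue `1`.
      set q : A := (1 / 2 : ℂ) • (1 + P) with hq
      have hq' : 1 - q = (1 / 2 : ℂ) • (1 - P) := by
        rw [hq]
        module
      have hqs : star q = q := by simp [hq, hPs]
      have hqq : q * q = q := by
        rw [hq, smul_mul_smul_comm, add_mul, mul_add, mul_add, hPP, mul_one, one_mul, mul_one]
        module
      have hqI : ∀ a ∈ fermionRegion c I, Commute q a := fun a ha =>
        ((Commute.one_left a).add_left (hPI a ha)).smul_left _
      let ι : fermionRegion c I →⋆ₐ[ℂ] A := (fermionRegion c I).subtype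
      -- Since `q - (1 - q) = P`, this is `a` on even and `a * P` on odd elements.
      let π : fermionRegion c I →⋆ₐ[ℂ] A := StarAlgHom.glue ι (Θ.comp ι) hqs hqq
        (fun b => hqI b b.2) (fun b => by
          change Commute q (Θ b)
          rw [← hg]
          exact hqI _ (Subtype.property _))
      have hπ : ∀ b, π b = b * q + Θ b * (1 - q) := fun _ => rfl
      have hπ_even : ∀ b, h.grading I b = b → π b = b := fun b hb => by
        rw [hπ, ← hg, hb, ← mul_add, add_sub_cancel, mul_one]
      have hπ_odd : ∀ b, h.grading I b = -b → π b * P = b := fun b hb => by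
        have : q - (1 - q) = P := by
          rw [hq', hq]
          module
        rw [hπ, ← hg, hb, NegMemClass.coe_neg, neg_mul, ← sub_eq_add_neg, ← mul_sub, this,
          mul_assoc, hPP, mul_one]
      have hΘq : Θ q = q := by
        rw [hq, map_smul, map_add, map_one, hΘP Θ hΘ]
      -- Multiplying `π a = 0` by `q` gives `a * q = 0`. Multiplying by `1 - q` and applying `Θ`,
      -- which fixes `q`, gives `a * (1 - q) = 0`.
      have hinj : Function.Injective π := by
        rw [injective_iff_map_eq_zero]
        intro a ha
        have hq1 : (1 - q) * q = 0 := by rw [sub_mul, one_mul, hqq, sub_self]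
        have hqq1 : (1 - q) * (1 - q) = 1 - q := by rw [mul_sub, mul_one, hq1, sub_zero]
        have hq2 : q * (1 - q) = 0 := by rw [mul_sub, mul_one, hqq, sub_self]
        rw [hπ] at ha
        have h1 : (a : A) * q = 0 := by
          have := congrArg (· * q) ha
          simpa only [add_mul, mul_assoc, hqq, hq1, mul_zero, add_zero, zero_mul] using this
        have h2 : (a : A) * (1 - q) = 0 := by
          have := congrArg (fun x => Θ x * (1 - q)) ha
          simpa only [map_add, map_mul, map_sub, map_one, map_zero, hΘq, hΘΘ (a : A), add_mul,
            mul_assoc, hqq1, hq2, mul_zero, zero_add, zero_mul] using this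
        refine Subtype.ext ?_
        have h3 := congrArg₂ (· + ·) h1 h2
        simpa only [← mul_add, add_sub_cancel, mul_one, add_zero, ZeroMemClass.coe_zero] using h3
      -- Passing `c j` exchanges `q` with `1 - q` and `b` with `Θ b`, hence the two summands of `π
      -- b`.
      have hcommc : ∀ b, ∀ j ∈ J.filter (· ∉ I), Commute (π b) (c j) := by
        intro b j hj
        have hjI := (Finset.mem_filter.mp hj).2
        have h1 : q * c j = c j * (1 - q) := by
          rw [hq', hq, smul_mul_assoc, add_mul, hPJ j hj, mul_smul_comm, mul_sub, one_mul, mul_one,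
            sub_eq_add_neg]
        have h2 : (1 - q) * c j = c j * q := by
          rw [sub_mul, h1, mul_sub, one_mul, mul_one, sub_sub_cancel]
        have h3 := h.mul_eq_grading_mul hjI hΘ b.2
        have h4 := h.mul_eq_grading_mul hjI hΘ (h.grading I b).2
        rw [hg, hΘΘ] at h4
        change π b * c j = c j * π b
        rw [hπ, add_mul, mul_add, mul_assoc, h1, mul_assoc, h2, ← mul_assoc, ← mul_assoc,
          ← mul_assoc, ← mul_assoc, h3, h4, add_comm]
      have hcomm : ∀ b j k, Commute (π b) (e j k) := by
        have hle : StarAlgebra.adjoin ℂ (c '' (J.filter (· ∉ I))) ≤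
            StarSubalgebra.centralizer ℂ (Set.range π) := by
          refine StarAlgebra.adjoin_le ?_
          rintro _ ⟨j, hj, rfl⟩
          rw [SetLike.mem_coe, StarSubalgebra.mem_centralizer_iff]
          rintro _ ⟨b, rfl⟩
          rw [← map_star]
          exact ⟨hcommc b j hj, hcommc (star b) j hj⟩
        exact fun b j k => ((StarSubalgebra.mem_centralizer_iff ℂ).mp (hle (he_mem j k)) _
          ⟨b, rfl⟩).1
      refine ⟨n, hn, hn', e, π, he, hinj, hcomm, ?_, fun a => ?_⟩
      · rintro _ ⟨j, hj, rfl⟩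
        exact hce j hj
      have hgg : h.grading I (h.grading I a) = a := Subtype.ext (by rw [hg, hg, hΘΘ])
      have heven : h.grading I ((1 / 2 : ℂ) • (a + h.grading I a))
          = (1 / 2 : ℂ) • (a + h.grading I a) := by
        rw [map_smul, map_add, hgg, add_comm]
      have hodd : h.grading I ((1 / 2 : ℂ) • (a - h.grading I a))
          = -((1 / 2 : ℂ) • (a - h.grading I a)) := by
        rw [map_smul, map_sub, hgg, ← smul_neg, neg_sub]
      have hsum : (1 / 2 : ℂ) • (a + h.grading I a) + (1 / 2 : ℂ) • (a - h.grading I a) = a := by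
        module
      -- Even and odd parts of `a`, with `u = P`; `α` commutes with the grading, so it maps them to
      -- those of `α a`.
      refine ⟨(1 / 2 : ℂ) • (a + h.grading I a), (1 / 2 : ℂ) • (a - h.grading I a), P, hPe, ?_, ?_⟩
      · rw [hπ_even _ heven, hπ_odd _ hodd, ← AddMemClass.coe_add, hsum]
      · rw [hπ_even _ (by rw [← hα, heven]), hπ_odd _ (by rw [← hα, hodd, map_neg]),
          ← AddMemClass.coe_add, ← map_add, hsum]
  refine ⟨T, hT, ?_⟩
  have hTc : Continuous T := (StarAlgEquiv.isometry T).continuous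
  have := fermionRegion_le (c := c) (I := Iᶜ)
    (T := StarAlgHom.equalizer (T : A →⋆ₐ[ℂ] A) (.id ℂ A)) (isClosed_eq hTc continuous_id)
    fun i hi => hT' {i} (c i) ⟨i, by simpa using hi, rfl⟩
  exact this

end IsFermionSystem

/-! ### The two halves of the chain -/

theorem compl_leftHalf : leftHalfᶜ = rightHalf := Set.compl_Iio

theorem compl_rightHalf : rightHalfᶜ = leftHalf := Set.compl_Ici

theorem proposition6 :
    -- quantum spin lattice systems
    (∀ (A : Type*) [CStarAlgebra A] (S : QuantumSpinSystem ℤ A)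
      (αL : S.region leftHalf ≃⋆ₐ[ℂ] S.region leftHalf)
      (αR : S.region rightHalf ≃⋆ₐ[ℂ] S.region rightHalf),
      ∃ α : A ≃⋆ₐ[ℂ] A, IsProductExtension αL αR α) ∧
    -- fermion lattice systems
    (∀ (A : Type*) [CStarAlgebra A] (c : ℤ → A) (hc : IsFermionSystem c)
      (αL : fermionRegion c leftHalf ≃⋆ₐ[ℂ] fermionRegion c leftHalf)
      (αR : fermionRegion c rightHalf ≃⋆ₐ[ℂ] fermionRegion c rightHalf),
      (∀ a, αL (hc.grading leftHalf a) = hc.grading leftHalf (αL a)) →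
      (∀ b, αR (hc.grading rightHalf b) = hc.grading rightHalf (αR b)) →
      ∃ α : A ≃⋆ₐ[ℂ] A, IsProductExtension αL αR α) := by
  refine ⟨fun A _ S αL αR => ?_, fun A _ c hc αL αR hL hR => ?_⟩
  · obtain ⟨T, hT, hT'⟩ := S.exists_extension leftHalf αL
    obtain ⟨U, hU, hU'⟩ := S.exists_extension rightHalf αR
    rw [compl_leftHalf] at hT'
    rw [compl_rightHalf] at hU'
    exact ⟨_, .of_extensions hT hT' hU hU'⟩
  · obtain ⟨T, hT, hT'⟩ := hc.exists_extension leftHalf αL hL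
    obtain ⟨U, hU, hU'⟩ := hc.exists_extension rightHalf αR hR
    rw [compl_leftHalf] at hT'
    rw [compl_rightHalf] at hU'
    exact ⟨_, .of_extensions hT hT' hU hU'⟩
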